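/- Let $w$ be the space of complex sequences, $\phi\subset w$ the space of finitely supported sequences, spanned by the unit sequences $\delta^j$, and let $p,q$ be sequences of nonnegative integers with $p(n)<q(n)$ for all $n$ and $q(n)\to\infty$. For $x\in w$ put $x^{(k)}=\sum_{j=1}^{k}x_j\delta^j$ and $\sigma_n x=\frac1{q(n)-p(n)}\sum_{k=p(n)+1}^{q(n)}x^{(k)}$. For an FK-space $X\supset\phi$ let $D_p^qW(X)$ be the set of $x\in X$ with $\sigma_nx\to x$ weakly in $X$, and let $D_p^qB(X)$ be the set of $x\in X$ for which $\{\sigma_nx\}_n$ is bounded in $X$. For an infinite complex matrix $A=(a_{nk})$ let $c_A$ be the space of all $x\in w$ for which all the series $(Ax)_n=\sum_{k=1}^\infty a_{nk}x_k$ converge and $\lim_Ax=\lim_n(Ax)_n$ exists, with its FK-topology, given by the seminorms $\sup_n|(Ax)_n|$, $|x_n|$ and $\sup_m|\sum_{k=1}^m a_{nk}x_k|$ $(n=1,2,\dots)$. A representation of a functional $f\in c_A'$ is an identity $$f(x)=\sum_{k=1}^\infty\beta_kx_k+\sum_{n=1}^\infty t_n(Ax)_n+\mu\lim\nolimits_Ax\qquad(x\in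 c_A)$$ with $t\in\ell^1$, $\mu\in\mathbb C$ and $\beta\in c_A^\beta$, that is, $\sum_k\beta_kx_k$ converges for all $x\in c_A$. The matrix $A$ is called $\mu$-unique if, for each $f\in c_A'$, all representations of $f$ have the same $\mu$; this $\mu$ is then Wilansky's invariant $\mu_A(f)$. **Theorem.** Let $A$ and $D$ be infinite complex matrices with $\phi\subset c_A\subset c_D$ and $D_p^qW(c_A)\ne D_p^qB(c_A)$. Then $A$ is $\mu$-unique, the restriction of $\lim_D$ to $c_A$ belongs to $c_A'$ and has a representation, and its invariant satisfies $\mu_A(\lim_D)=0$ if and only if $c_D$ is deferred Cesàro conull with respect to $c_A$, that is, $D_p^qB(c_A)\subseteq D_p^qW(c_D)$. -/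

import Mathlib

open Filter Topology

noncomputable section

namespace DeferredCesaro

/-! Sequences are functions `ℕ → ℂ`; the entry `x k` is the `(k+1)`-st term of the sequence, so that
the first `k` terms are those with index in `Finset.range k`. -/

/-! ### Series in the sense of convergent partial sums -/

/-- The partial sums of `∑ u k` converge (possibly conditionally). -/
def SeriesConverges (u : ℕ → ℂ) : Prop :=
  ∃ s : ℂ, Tendsto (fun m => ∑ k ∈ Finset.range m, u k) atTop (𝓝 s)

/-- The sum of the series `∑ u k`, the limit of its partial sums (meaningful if it converges). -/
def seriesSum (u : ℕ → ℂ) : ℂ :=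
  limUnder atTop (fun m => ∑ k ∈ Finset.range m, u k)

theorem SeriesConverges.tendsto {u : ℕ → ℂ} (h : SeriesConverges u) :
    Tendsto (fun m => ∑ k ∈ Finset.range m, u k) atTop (𝓝 (seriesSum u)) :=
  tendsto_nhds_limUnder h

theorem tendsto_add {u v : ℕ → ℂ} (hu : SeriesConverges u) (hv : SeriesConverges v) :
    Tendsto (fun m => ∑ k ∈ Finset.range m, (u k + v k)) atTop
      (𝓝 (seriesSum u + seriesSum v)) := by
  simpa only [Finset.sum_add_distrib] using hu.tendsto.add hv.tendsto

theorem tendsto_smul {u : ℕ → ℂ} (c : ℂ) (hu : SeriesConverges u) :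
    Tendsto (fun m => ∑ k ∈ Finset.range m, (c * u k)) atTop (𝓝 (c * seriesSum u)) := by
  simpa only [Finset.mul_sum] using hu.tendsto.const_mul c

/-! ### The summability domain of a matrix -/

/-- The transform `A x`, with entries `(A x)_n = ∑_k a_{nk} x_k`. -/
def transform (A : Matrix ℕ ℕ ℂ) (x : ℕ → ℂ) (n : ℕ) : ℂ :=
  seriesSum fun k => A n k * x k

theorem transform_add {A : Matrix ℕ ℕ ℂ} {x y : ℕ → ℂ}
    (hx : ∀ n, SeriesConverges fun k => A n k * x k)
    (hy : ∀ n, SeriesConverges fun k => A n k * y k) :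
    transform A (x + y) = transform A x + transform A y := by
  funext n
  refine Tendsto.limUnder_eq ?_
  change Tendsto _ atTop (𝓝 (seriesSum _ + seriesSum _))
  simpa only [Pi.add_apply, mul_add] using tendsto_add (hx n) (hy n)

theorem transform_smul {A : Matrix ℕ ℕ ℂ} (c : ℂ) {x : ℕ → ℂ}
    (hx : ∀ n, SeriesConverges fun k => A n k * x k) :
    transform A (c • x) = c • transform A x := by
  funext n
  refine Tendsto.limUnder_eq ?_
  change Tendsto _ atTop (𝓝 (c * seriesSum _))
  simpa only [Pi.smul_apply, smul_eq_mul, mul_left_comm] using tendsto_smul c (hx n)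

/-- The summability domain `c_A`: all `x` such that `A x` exists and is a convergent sequence. -/
def cDom (A : Matrix ℕ ℕ ℂ) : Submodule ℂ (ℕ → ℂ) where
  carrier := {x | (∀ n, SeriesConverges fun k => A n k * x k) ∧
    ∃ L : ℂ, Tendsto (transform A x) atTop (𝓝 L)}
  zero_mem' := by
    have h : ∀ n, SeriesConverges fun k => A n k * (0 : ℕ → ℂ) k := fun n => ⟨0, by simp⟩
    refine ⟨h, 0, ?_⟩
    have h0 := transform_smul (A := A) 0 h
    rw [zero_smul, zero_smul] at h0
    rw [h0]
    exact tendsto_const_nhds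
  add_mem' := by
    rintro x y ⟨hx, L, hL⟩ ⟨hy, M, hM⟩
    refine ⟨fun n => ⟨_, by simpa only [Pi.add_apply, mul_add] using tendsto_add (hx n) (hy n)⟩,
      L + M, ?_⟩
    rw [transform_add hx hy]
    exact hL.add hM
  smul_mem' := by
    rintro c x ⟨hx, L, hL⟩
    refine ⟨fun n => ⟨_, by
      simpa only [Pi.smul_apply, smul_eq_mul, mul_left_comm] using tendsto_smul c (hx n)⟩,
      c • L, ?_⟩
    rw [transform_smul c hx]
    exact hL.const_smul c

/-- `x ↦ A x` as a linear map on `c_A`. -/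
def transformₗ (A : Matrix ℕ ℕ ℂ) : cDom A →ₗ[ℂ] (ℕ → ℂ) where
  toFun x := transform A x
  map_add' x y := transform_add x.2.1 y.2.1
  map_smul' c x := transform_smul c x.2.1

/-- The functional `lim_A x = lim_n (A x)_n` on `c_A`. -/
def limFun (A : Matrix ℕ ℕ ℂ) : cDom A →ₗ[ℂ] ℂ where
  toFun x := limUnder atTop (transform A x)
  map_add' x y := by
    refine Tendsto.limUnder_eq ?_
    rw [show transform A (x + y : cDom A) = _ from transform_add x.2.1 y.2.1]
    exact (tendsto_nhds_limUnder x.2.2).add (tendsto_nhds_limUnder y.2.2)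
  map_smul' c x := by
    refine Tendsto.limUnder_eq ?_
    rw [show transform A (c • x : cDom A) = _ from transform_smul c x.2.1]
    exact (tendsto_nhds_limUnder x.2.2).const_smul c

/-- The partial sums `∑_{k < m} a_{nk} x_k` of the `n`-th row, as a sequence in `m`. -/
def rowPartial (A : Matrix ℕ ℕ ℂ) (n : ℕ) : cDom A →ₗ[ℂ] (ℕ → ℂ) where
  toFun x m := ∑ k ∈ Finset.range m, A n k * (x : ℕ → ℂ) k
  map_add' x y := by
    funext m
    simp [mul_add, Finset.sum_add_distrib]
  map_smul' c x := by
    funext m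
    simp [Finset.mul_sum, mul_left_comm]

/-! ### The FK-topology of `c_A` -/

/-- The seminorm `x ↦ sup_n |(T x)_n|` for a linear map `T` into the bounded sequences. -/
def supSeminorm {E : Type*} [AddCommGroup E] [Module ℂ E] (T : E →ₗ[ℂ] (ℕ → ℂ))
    (hT : ∀ x, BddAbove (Set.range fun n => ‖T x n‖)) : Seminorm ℂ E :=
  Seminorm.of (fun x => ⨆ n, ‖T x n‖)
    (fun x y => by
      refine ciSup_le fun n => ?_
      rw [map_add]
      exact (norm_add_le _ _).trans (add_le_add (le_ciSup (hT x) n) (le_ciSup (hT y) n)))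
    (fun c x => by
      simp only [map_smul, Pi.smul_apply, norm_smul]
      exact (Real.mul_iSup_of_nonneg (norm_nonneg c) _).symm)

/-- `ρ₀(x) = sup_n |∑_k a_{nk} x_k|`. -/
def rhoZero (A : Matrix ℕ ℕ ℂ) : Seminorm ℂ (cDom A) :=
  supSeminorm (transformₗ A) fun x => (x.2.2.choose_spec.norm).bddAbove_range

/-- `ρ_n(x) = |x_n|`. -/
def rho (A : Matrix ℕ ℕ ℂ) (n : ℕ) : Seminorm ℂ (cDom A) :=
  (normSeminorm ℂ ℂ).comp ((LinearMap.proj n).comp (cDom A).subtype)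

/-- `h_n(x) = sup_m |∑_{k ≤ m} a_{nk} x_k|`. -/
def rowSeminorm (A : Matrix ℕ ℕ ℂ) (n : ℕ) : Seminorm ℂ (cDom A) :=
  supSeminorm (rowPartial A n) fun x => ((x.2.1 n).tendsto.norm).bddAbove_range

/-- The family of seminorms `ρ₀`, `ρ_n`, `h_n` that defines the topology of `c_A`. -/
def cSeminorms (A : Matrix ℕ ℕ ℂ) : SeminormFamily ℂ (cDom A) (Unit ⊕ ℕ ⊕ ℕ) :=
  Sum.elim (fun _ => rhoZero A) (Sum.elim (rho A) (rowSeminorm A))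

/-! ### Topologised sequence spaces and their distinguished subspaces -/

/-- The space `φ` of finite sequences, the linear span of the unit sequences `δ^j`. -/
def phi : Submodule ℂ (ℕ → ℂ) :=
  Submodule.span ℂ (Set.range fun j : ℕ => (Pi.single j 1 : ℕ → ℂ))

/-- A sequence space that contains `φ`, with a topology of its own (which in general is not the
topology of coordinatewise convergence). -/
structure SeqSpace where
  /-- the sequences in the space -/
  carrier : Submodule ℂ (ℕ → ℂ)
  /-- the topology of the space -/
  topology : TopologicalSpace carrier
  /-- the space contains all finite sequences -/
  phi_le : phi ≤ carrier

/-- The elements of `X`; a synonym that carries the topology of `X` and not that of `ℕ → ℂ`. -/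
def SeqSpace.Elem (X : SeqSpace) : Type := X.carrier

instance (X : SeqSpace) : AddCommGroup X.Elem := inferInstanceAs (AddCommGroup X.carrier)

instance (X : SeqSpace) : Module ℂ X.Elem := inferInstanceAs (Module ℂ X.carrier)

instance (X : SeqSpace) : TopologicalSpace X.Elem := X.topology

/-- The FK-space `c_A`, topologised by the seminorms `ρ₀`, `ρ_n`, `h_n`. -/
def cSpace (A : Matrix ℕ ℕ ℂ) (hA : phi ≤ cDom A) : SeqSpace where
  carrier := cDom A
  topology := (cSeminorms A).moduleFilterBasis.topology
  phi_le := hA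

/-- The unit sequence `δ^j` as an element of `X`. -/
def SeqSpace.delta (X : SeqSpace) (j : ℕ) : X.Elem :=
  (⟨Pi.single j 1, X.phi_le (Submodule.subset_span ⟨j, rfl⟩)⟩ : X.carrier)

/-- The section `x^{(k)} = ∑_{j ≤ k} x_j δ^j` (the first `k` terms of `x`), in `X`. -/
def SeqSpace.sect (X : SeqSpace) (x : ℕ → ℂ) (k : ℕ) : X.Elem :=
  ∑ j ∈ Finset.range k, x j • X.delta j

/-- The deferred Cesàro section `(q(n) - p(n))⁻¹ ∑_{k = p(n)+1}^{q(n)} x^{(k)}`, in `X`. -/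
def SeqSpace.deferredSect (X : SeqSpace) (p q : ℕ → ℕ) (x : ℕ → ℂ) (n : ℕ) : X.Elem :=
  ((q n : ℂ) - (p n : ℂ))⁻¹ • ∑ k ∈ Finset.Ioc (p n) (q n), X.sect x k

/-- `D_p^q W(X)`: the `x` in `X` whose deferred Cesàro sections converge to `x` weakly in `X`. -/
def DW (p q : ℕ → ℕ) (X : SeqSpace) : Set (ℕ → ℂ) :=
  {x | ∃ hx : x ∈ X.carrier, ∀ f : X.Elem →L[ℂ] ℂ,
    Tendsto (fun n => f (X.deferredSect p q x n)) atTop (𝓝 (f (⟨x, hx⟩ : X.carrier)))}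

/-- `D_p^q B(X)`: the `x` in `X` whose deferred Cesàro sections form a bounded set in `X`. -/
def DB (p q : ℕ → ℕ) (X : SeqSpace) : Set (ℕ → ℂ) :=
  {x | x ∈ X.carrier ∧ Bornology.IsVonNBounded ℂ (Set.range (X.deferredSect p q x))}

/-- `Y` is deferred Cesàro conull with respect to `X` (for `X ⊆ Y` and
`D_p^q W(X) ≠ D_p^q B(X)`). -/
def ConullWrt (p q : ℕ → ℕ) (X Y : SeqSpace) : Prop :=
  DB p q X ⊆ DW p q Y

/-! ### Wilansky's invariant -/

/-- The `β`-dual of a set of sequences. -/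
def betaDual (S : Set (ℕ → ℂ)) : Set (ℕ → ℂ) :=
  {b | ∀ x ∈ S, SeriesConverges fun k => b k * x k}

/-- `f` has a representation `f(x) = ∑_k β_k x_k + ∑_n t_n (A x)_n + μ lim_A x` on `c_A` with
`t ∈ ℓ¹`, `β` in the `β`-dual of `c_A` and the given `μ`. -/
def RepresentedWith (A : Matrix ℕ ℕ ℂ) (f : cDom A →ₗ[ℂ] ℂ) (μ : ℂ) : Prop :=
  ∃ b ∈ betaDual (cDom A : Set (ℕ → ℂ)), ∃ t : ℕ → ℂ, (Summable fun n => ‖t n‖) ∧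
    ∀ x : cDom A, f x =
      seriesSum (fun k => b k * (x : ℕ → ℂ) k) + ∑' n, t n * transform A x n + μ * limFun A x

/-- The linear functional `f` on `c_A` belongs to the topological dual of the FK-space `c_A`. -/
def InDual (A : Matrix ℕ ℕ ℂ) (f : cDom A →ₗ[ℂ] ℂ) : Prop :=
  Continuous[(cSeminorms A).moduleFilterBasis.topology, inferInstance] f

/-- `A` is `μ`-unique: for each `f` in the dual of `c_A`, all representations have the same `μ`. -/
def MuUnique (A : Matrix ℕ ℕ ℂ) : Prop :=
  ∀ f : cDom A →ₗ[ℂ] ℂ, InDual A f →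
    ∀ μ ν : ℂ, RepresentedWith A f μ → RepresentedWith A f ν → μ = ν

open Classical in
/-- Wilansky's invariant `μ_A(f)`: the coefficient `μ` in a representation of `f` (and `0` if there
is none); it is well defined if `A` is `μ`-unique and `f` has a representation. -/
def muInv (A : Matrix ℕ ℕ ℂ) (f : cDom A →ₗ[ℂ] ℂ) : ℂ :=
  if h : ∃ μ : ℂ, RepresentedWith A f μ then h.choose else 0

/-- The restriction of `lim_D` to `c_A`, for `c_A ⊆ c_D`. -/
def limRestrict {A D : Matrix ℕ ℕ ℂ} (h : cDom A ≤ cDom D) : cDom A →ₗ[ℂ] ℂ :=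
  (limFun D).comp (Submodule.inclusion h)

end DeferredCesaro

end

/-! Every continuous functional on $c_A$ has a representation $(\beta,t,\mu)$. Let $x\in
D_p^qB(c_A)$ and evaluate such an $f$ along the sections $\sigma_nx$. Deferred means are regular, so
the $\beta$-part converges to its value at $x$, and so does each $(A\sigma_nx)_m$. The numbers
$(A\sigma_nx)_m$ are bounded uniformly in $n,m$, so dominated convergence handles the $\ell^1$-part.
What remains is the key relation (`RepresentedWith.tendsto_deferredSect`)
$$f(\sigma_nx)-f(x)-\mu\,(\lim\nolimits_A\sigma_nx-\lim\nolimits_Ax)\to0.$$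

Hence a member of $D_p^qB(c_A)$ lies in $D_p^qW(c_A)$ once $\lim_A\sigma_nx\to\lim_Ax$
(`mem_DW_of_tendsto_limFun`). If the two sets differ, some bounded $x$ violates this, and at that
$x$ the relation determines $\mu$.

For $f=\lim_D$, continuity comes from that of the inclusion $c_A\to c_D$
(`continuous_elemInclusion`), by barrelledness. If $\mu=0$, the relation gives
$\lim_D\sigma_ny\to\lim_Dy$ on $D_p^qB(c_A)\subseteq D_p^qB(c_D)$, and the criterion for $D$ yields
weak convergence in $c_D$. Conversely, weak convergence tested on $\lim_D$ at the bad $x$ forces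
$\mu=0$. -/

noncomputable section

namespace DeferredCesaro

/-! ### Functionals dominated by seminorms; weak boundedness -/

/-- A functional dominated by the pull-back of a seminorm along `T` factors through `T`, with a
factor dominated by that seminorm. -/
theorem exists_factor_of_le_seminorm {E F : Type*} [AddCommGroup E] [Module ℂ E]
    [AddCommGroup F] [Module ℂ F] (T : E →ₗ[ℂ] F) (q : Seminorm ℂ F) (f : E →ₗ[ℂ] ℂ)
    (hf : ∀ x, ‖f x‖ ≤ q (T x)) :
    ∃ g : F →ₗ[ℂ] ℂ, (∀ x, f x = g (T x)) ∧ ∀ y, ‖g y‖ ≤ q y := by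
  obtain ⟨r, hr⟩ := T.rangeRestrict.exists_rightInverse_of_surjective T.range_rangeRestrict
  have hr' : ∀ y : LinearMap.range T, T (r y) = y := fun y =>
    congrArg Subtype.val (LinearMap.congr_fun hr y)
  obtain ⟨g, hg, hgq⟩ := Module.Dual.exists_extension_of_le_seminorm (LinearMap.range T)
    (f ∘ₗ r) (p := q) (fun y => by
      have := hf (r y)
      rwa [hr'] at this)
  refine ⟨g, fun x => ?_, hgq⟩
  -- `T` kills `x - r (T x)`, so the domination makes `f` vanish there: `f` does not depend on the
  -- chosen preimage.
  have h1 : f x = f (r (T.rangeRestrict x)) := by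
    have := hf (x - r (T.rangeRestrict x))
    rw [map_sub T, hr', show ((T.rangeRestrict x : LinearMap.range T) : F) = T x from rfl, sub_self, map_zero q, map_sub] at this
    exact sub_eq_zero.1 (norm_le_zero_iff.1 this)
  rw [h1]
  exact (hg (T.rangeRestrict x)).symm

theorem seminorm_sum_apply {ι E : Type*} [AddCommGroup E] [Module ℂ E] (s : Finset ι)
    (p : ι → Seminorm ℂ E) (x : E) : (∑ i ∈ s, p i) x = ∑ i ∈ s, p i x :=
  (congrFun (map_sum (FunLike.coeAddMonoidHom (F := Seminorm ℂ E) (α := E) (β := ℝ)) p s) x).trans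
    (Finset.sum_apply _ _ _)

/-- A functional dominated by a finite sum of seminorms is a sum of functionals that are dominated
by the single seminorms. -/
theorem exists_sum_of_le_sum {ι E : Type*} [AddCommGroup E] [Module ℂ E] (s : Finset ι)
    (p : ι → Seminorm ℂ E) (f : E →ₗ[ℂ] ℂ) (hf : ∀ x, ‖f x‖ ≤ ∑ i ∈ s, p i x) :
    ∃ g : ι → E →ₗ[ℂ] ℂ, f = ∑ i ∈ s, g i ∧ ∀ i, ∀ x, ‖g i x‖ ≤ p i x := by
  classical
  induction s using Finset.induction_on generalizing f with
  | empty =>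
    refine ⟨fun _ => 0, ?_, fun i x => by simp⟩
    ext x
    simpa using hf x
  | insert a s ha ih =>
    let Q : Seminorm ℂ E := ∑ i ∈ s, p i
    have hQ : ∀ x, Q x = ∑ i ∈ s, p i x := seminorm_sum_apply s p
    -- View `f` as a functional on the diagonal of `E × E`, extend it under the sum of the two
    -- seminorms, and restrict the extension to the two axes.
    obtain ⟨G, hG, hGq⟩ := exists_factor_of_le_seminorm
      (LinearMap.id.prod LinearMap.id : E →ₗ[ℂ] E × E)
      ((p a).comp (LinearMap.fst ℂ E E) + Q.comp (LinearMap.snd ℂ E E)) f (fun x => by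
        simpa [Finset.sum_insert ha, hQ] using hf x)
    obtain ⟨g, hg, hgp⟩ := ih (G ∘ₗ LinearMap.inr ℂ E E) (fun x => by
      simpa [hQ] using hGq (0, x))
    refine ⟨fun i => if i = a then G ∘ₗ LinearMap.inl ℂ E E else g i, ?_, fun i x => ?_⟩
    · rw [Finset.sum_insert ha, if_pos rfl,
        Finset.sum_congr rfl fun i hi => if_neg fun h : i = a => ha (h ▸ hi), ← hg]
      ext x
      rw [hG x]
      simp [← map_add]
    · by_cases h : i = a
      · subst h
        simpa using hGq (x, 0)
      · simpa [h] using hgp i x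

/-- The uniform boundedness principle in a seminormed space. -/
theorem bddAbove_seminorm_of_weakly_bounded {ι E : Type*} [AddCommGroup E] [Module ℂ E]
    (q : Seminorm ℂ E) (u : ι → E)
    (h : ∀ f : E →ₗ[ℂ] ℂ, ∀ C : ℝ, (∀ x, ‖f x‖ ≤ C * q x) → ∃ M, ∀ n, ‖f (u n)‖ ≤ M) :
    ∃ M, ∀ n, q (u n) ≤ M := by
  let _ : SeminormedAddCommGroup E := q.toSeminormedAddCommGroup
  let _ : NormedSpace ℂ E := ⟨fun c x => (map_smul_eq_mul q c x).le⟩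
  -- The operators act on the dual, which is complete even though `E` need not be.
  obtain ⟨M, hM⟩ := banach_steinhaus
    (g := fun n => NormedSpace.inclusionInDoubleDual ℂ E (u n)) (fun f =>
      h f.toLinearMap ‖f‖ fun x => f.le_opNorm x)
  refine ⟨max M 0, fun n => NormedSpace.norm_le_dual_bound ℂ (u n) (le_max_right _ _) fun f => ?_⟩
  calc ‖f (u n)‖ = ‖NormedSpace.inclusionInDoubleDual ℂ E (u n) f‖ := rfl
    _ ≤ ‖NormedSpace.inclusionInDoubleDual ℂ E (u n)‖ * ‖f‖ := ContinuousLinearMap.le_opNorm _ _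
    _ ≤ max M 0 * ‖f‖ := by gcongr; exact (hM n).trans (le_max_left _ _)

theorem continuous_functional_iff {ι E : Type*} [AddCommGroup E] [Module ℂ E]
    [TopologicalSpace E] {p : SeminormFamily ℂ E ι} (hp : WithSeminorms p) (f : E →ₗ[ℂ] ℂ) :
    Continuous f ↔ ∃ s : Finset ι, ∃ C : NNReal, ∀ x, ‖f x‖ ≤ C * s.sup p x := by
  constructor
  · intro hf
    obtain ⟨s, C, -, h⟩ := Seminorm.bound_of_continuous hp ((normSeminorm ℂ ℂ).comp f) hf.norm
    exact ⟨s, C, h⟩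
  · rintro ⟨s, C, h⟩
    exact hp.continuous_normedSpace_rng ℂ f ⟨s, C, h⟩

/-- Weakly bounded families are bounded. -/
theorem isVonNBounded_of_weakly_bounded {ι κ E : Type*} [AddCommGroup E] [Module ℂ E]
    [TopologicalSpace E] {p : SeminormFamily ℂ E ι} (hp : WithSeminorms p) (u : κ → E)
    (h : ∀ f : E →L[ℂ] ℂ, ∃ M, ∀ n, ‖f (u n)‖ ≤ M) :
    Bornology.IsVonNBounded ℂ (Set.range u) := by
  rw [hp.isVonNBounded_iff_seminorm_bddAbove]
  intro i
  obtain ⟨M, hM⟩ := bddAbove_seminorm_of_weakly_bounded (p i) u fun f C hC => by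
    refine h ⟨f, (continuous_functional_iff hp f).2 ⟨{i}, C.toNNReal, fun x => (hC x).trans ?_⟩⟩
    rw [Finset.sup_singleton]
    exact mul_le_mul_of_nonneg_right (Real.le_coe_toNNReal C) (apply_nonneg _ _)
  refine ⟨M, ?_⟩
  rintro _ ⟨_, ⟨n, rfl⟩, rfl⟩
  exact hM n

/-! ### Regularity of deferred Cesàro means -/

/-- Deferred Cesàro means are regular. -/
theorem tendsto_deferred_mean {p q : ℕ → ℕ} (hpq : ∀ n, p n < q n) (hq : Tendsto q atTop atTop)
    {u : ℕ → ℂ} {s : ℂ} (hu : Tendsto u atTop (𝓝 s)) :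
    Tendsto (fun n => ((q n : ℂ) - (p n : ℂ))⁻¹ * ∑ k ∈ Finset.Ioc (p n) (q n), u k)
      atTop (𝓝 s) := by
  obtain ⟨M, hM⟩ : ∃ M, ∀ k, ‖u k - s‖ ≤ M := by
    obtain ⟨M, hM⟩ := ((hu.sub_const s).norm).bddAbove_range
    exact ⟨M, fun k => hM ⟨k, rfl⟩⟩
  have hM0 : 0 ≤ M := (norm_nonneg _).trans (hM 0)
  rw [Metric.tendsto_atTop]
  intro ε hε
  obtain ⟨K, hK⟩ := Metric.tendsto_atTop.1 hu (ε / 2) (half_pos hε)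
  obtain ⟨R, hR⟩ := exists_nat_gt (2 * M * K / ε)
  obtain ⟨N, hN⟩ := eventually_atTop.1 ((tendsto_atTop.1 hq) (max R K + 1))
  refine ⟨N, fun n hn => ?_⟩
  have hqn := hN n hn
  have hlt := hpq n
  have hd : (0 : ℝ) < (q n : ℝ) - p n := by
    rw [sub_pos]
    exact_mod_cast hlt
  have hdc : (q n : ℂ) - p n = (((q n : ℝ) - p n : ℝ) : ℂ) := by push_cast; rfl
  have hd0 : (q n : ℂ) - p n ≠ 0 := by
    rw [hdc]
    exact_mod_cast hd.ne'
  have hcard : ∑ k ∈ Finset.Ioc (p n) (q n), (1 : ℝ) = (q n : ℝ) - p n := by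
    simp [Nat.cast_sub hlt.le]
  have hcardc : ∑ k ∈ Finset.Ioc (p n) (q n), s = ((q n : ℂ) - p n) * s := by
    simp [Nat.cast_sub hlt.le]
  have hsum : ((q n : ℂ) - (p n : ℂ))⁻¹ * ∑ k ∈ Finset.Ioc (p n) (q n), u k - s =
      ((q n : ℂ) - (p n : ℂ))⁻¹ * ∑ k ∈ Finset.Ioc (p n) (q n), (u k - s) := by
    rw [Finset.sum_sub_distrib, hcardc, mul_sub, inv_mul_cancel_left₀ hd0]
  rw [dist_eq_norm, hsum, norm_mul, norm_inv, hdc, Complex.norm_real, Real.norm_of_nonneg hd.le,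
    inv_mul_lt_iff₀ hd]
  -- The indices `k ≤ K` make up at most the proportion `K / q n` of the window, whatever its
  -- length. This is why `q → ∞` suffices and `q - p → ∞` is not needed.
  have hfew : ∑ k ∈ Finset.Ioc (p n) (q n), (if k ≤ K then (1 : ℝ) else 0) * q n
      ≤ K * (q n - p n) := by
    rw [← Finset.sum_mul, ← Finset.sum_filter, Finset.sum_const, nsmul_eq_mul, mul_one]
    have hc : ((Finset.Ioc (p n) (q n)).filter (· ≤ K)).card ≤ K - p n := by
      rw [← Nat.card_Ioc]
      refine Finset.card_le_card fun k hk => ?_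
      simp only [Finset.mem_filter, Finset.mem_Ioc] at hk ⊢
      omega
    have hc' : (K - p n) * q n ≤ K * (q n - p n) := by
      rcases le_total K (p n) with h | h
      · simp [Nat.sub_eq_zero_of_le h]
      · zify [h, hlt.le]
        have : K ≤ q n := by omega
        nlinarith [mul_le_mul_of_nonneg_left this (Nat.zero_le (p n))]
    have := (Nat.mul_le_mul_right (q n) hc).trans hc'
    have h3 : ((((Finset.Ioc (p n) (q n)).filter (· ≤ K)).card * q n : ℕ) : ℝ) ≤
      ((K * (q n - p n) : ℕ) : ℝ) := by exact_mod_cast this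
    rw [Nat.cast_mul, Nat.cast_mul, Nat.cast_sub hlt.le] at h3
    exact h3
  have hq0 : (0 : ℝ) < q n := by
    have : 0 < q n := by omega
    exact_mod_cast this
  have hMK : M * K < ε / 2 * q n := by
    have h1 : (R : ℝ) < q n := by
      have : R < q n := by omega
      exact_mod_cast this
    have h2 := (div_lt_iff₀ hε).1 (hR.trans h1)
    linarith
  rw [← Finset.sum_mul] at hfew
  set F := ∑ k ∈ Finset.Ioc (p n) (q n), (if k ≤ K then (1 : ℝ) else 0) with hF
  have hMF : M * F < ε / 2 * (q n - p n) := by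
    have h1 : M * F * q n ≤ M * K * (q n - p n) := by
      calc M * F * q n = M * (F * q n) := by ring
        _ ≤ M * (K * (q n - p n)) := mul_le_mul_of_nonneg_left hfew hM0
        _ = _ := by ring
    have h2 : M * K * (q n - p n) < ε / 2 * q n * (q n - p n) := mul_lt_mul_of_pos_right hMK hd
    have h3 : M * F * q n < ε / 2 * (q n - p n) * q n := by linarith
    exact lt_of_mul_lt_mul_right h3 hq0.le
  calc ‖∑ k ∈ Finset.Ioc (p n) (q n), (u k - s)‖
      ≤ ∑ k ∈ Finset.Ioc (p n) (q n), (M * (if k ≤ K then (1 : ℝ) else 0) + ε / 2 * 1) := by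
        refine (norm_sum_le _ _).trans (Finset.sum_le_sum fun k _ => ?_)
        split_ifs with hk
        · linarith [hM k]
        · have := hK k (by omega)
          rw [dist_eq_norm] at this
          linarith
    _ = M * F + ε / 2 * (q n - p n) := by
        rw [Finset.sum_add_distrib, ← Finset.mul_sum, ← Finset.mul_sum, hcard]
    _ < (q n - p n) * ε := by linarith

/-! ### Bounded functionals on convergent sequences -/

theorem le_supSeminorm {E : Type*} [AddCommGroup E] [Module ℂ E] (T : E →ₗ[ℂ] (ℕ → ℂ))
    (hT : ∀ x, BddAbove (Set.range fun n => ‖T x n‖)) (x : E) (n : ℕ) :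
    ‖T x n‖ ≤ supSeminorm T hT x :=
  le_ciSup (hT x) n

theorem supSeminorm_le {E : Type*} [AddCommGroup E] [Module ℂ E] (T : E →ₗ[ℂ] (ℕ → ℂ))
    (hT : ∀ x, BddAbove (Set.range fun n => ‖T x n‖)) {x : E} {M : ℝ} (h : ∀ n, ‖T x n‖ ≤ M) :
    supSeminorm T hT x ≤ M :=
  ciSup_le h

/-- The space of convergent sequences. -/
def convSeq : Submodule ℂ (ℕ → ℂ) where
  carrier := {y | ∃ L : ℂ, Tendsto y atTop (𝓝 L)}
  zero_mem' := ⟨0, tendsto_const_nhds⟩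
  add_mem' := fun ⟨L, hL⟩ ⟨M, hM⟩ => ⟨L + M, hL.add hM⟩
  smul_mem' := fun c _ ⟨L, hL⟩ => ⟨c • L, hL.const_smul c⟩

theorem convSeq_bddAbove (y : convSeq) :
    BddAbove (Set.range fun n => ‖convSeq.subtype y n‖) :=
  (y.2.choose_spec.norm).bddAbove_range

theorem single_mem_convSeq (n : ℕ) : (Pi.single n 1 : ℕ → ℂ) ∈ convSeq :=
  ⟨0, tendsto_const_nhds.congr' ((eventually_gt_atTop n).mono fun k hk => by
    rw [Pi.single_eq_of_ne hk.ne'])⟩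

/-- The form of the bounded functionals on the space of convergent sequences. -/
theorem exists_functional_rep_convSeq (g : convSeq →ₗ[ℂ] ℂ) {C : ℝ}
    (hg : ∀ y, ‖g y‖ ≤ C * supSeminorm convSeq.subtype convSeq_bddAbove y) :
    ∃ t : ℕ → ℂ, ∃ μ : ℂ, (Summable fun n => ‖t n‖) ∧ ∀ (y : convSeq) (L : ℂ),
      Tendsto (y : ℕ → ℂ) atTop (𝓝 L) → g y = ∑' n, t n * (y : ℕ → ℂ) n + μ * L := by
  let e : ℕ → convSeq := fun n => ⟨Pi.single n 1, single_mem_convSeq n⟩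
  let one : convSeq := ⟨fun _ => 1, 1, tendsto_const_nhds⟩
  have hcoe : ∀ (u : Finset ℕ) (c : ℕ → ℂ) (m : ℕ),
      ((∑ n ∈ u, c n • e n : convSeq) : ℕ → ℂ) m = if m ∈ u then c m else 0 := by
    intro u c m
    simp [e, Finset.sum_apply, Pi.single_apply]
  have hC : 0 ≤ C := by
    have h1 : (0 : ℝ) ≤ C * supSeminorm convSeq.subtype convSeq_bddAbove one :=
      (norm_nonneg _).trans (hg one)
    have h2 : (1 : ℝ) ≤ supSeminorm convSeq.subtype convSeq_bddAbove one := by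
      simpa [one] using le_supSeminorm convSeq.subtype convSeq_bddAbove one 0
    exact nonneg_of_mul_nonneg_left h1 (zero_lt_one.trans_le h2)
  have hsum : Summable fun n => ‖g (e n)‖ := by
    refine summable_of_sum_le (c := C) (fun _ => norm_nonneg _) fun u => ?_
    -- Conjugate phases turn `g` of the combination into `∑ ‖g (e n)‖` while its supremum norm stays
    -- at most 1; where `g (e n) = 0`, division by zero gives the harmless value 0.
    let c : ℕ → ℂ := fun n => (starRingEnd ℂ) (g (e n)) / ‖g (e n)‖
    have hgc : g (∑ n ∈ u, c n • e n) = ((∑ n ∈ u, ‖g (e n)‖ : ℝ) : ℂ) := by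
      rw [map_sum]
      push_cast
      refine Finset.sum_congr rfl fun n _ => ?_
      rw [map_smul, smul_eq_mul]
      by_cases h : g (e n) = 0
      · simp [h]
      · have h' : (‖g (e n)‖ : ℂ) ≠ 0 := by simpa using h
        simp only [c]
        rw [div_mul_eq_mul_div, mul_comm, Complex.mul_conj, Complex.normSq_eq_norm_sq]
        push_cast
        field_simp
    have hle : supSeminorm convSeq.subtype convSeq_bddAbove (∑ n ∈ u, c n • e n) ≤ 1 := by
      refine supSeminorm_le _ _ fun m => ?_
      rw [Submodule.subtype_apply, hcoe]
      split_ifs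
      · simp only [c, norm_div, RCLike.norm_conj, Complex.norm_real, norm_norm]
        exact div_self_le_one _
      · simp
    have := (hg (∑ n ∈ u, c n • e n)).trans (mul_le_mul_of_nonneg_left hle hC)
    rw [hgc, Complex.norm_real, mul_one] at this
    exact (le_abs_self _).trans this
  -- These coefficients come from the norm-convergent expansion `y = L • one + ∑ (y n - L) • e n`.
  refine ⟨fun n => g (e n), g one - ∑' n, g (e n), hsum, fun y L hy => ?_⟩
  have hyb : Summable fun n => g (e n) * (y : ℕ → ℂ) n := by
    obtain ⟨M, hM⟩ := convSeq_bddAbove y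
    refine Summable.of_norm_bounded (g := fun n => ‖g (e n)‖ * M) (hsum.mul_right M) fun n => ?_
    rw [norm_mul]
    exact mul_le_mul_of_nonneg_left (hM ⟨n, rfl⟩) (norm_nonneg _)
  have hs : HasSum (fun n => g (e n) * ((y : ℕ → ℂ) n - L))
      (∑' n, g (e n) * (y : ℕ → ℂ) n - (∑' n, g (e n)) * L) := by
    simp_rw [mul_sub]
    exact hyb.hasSum.sub (hsum.of_norm.hasSum.mul_right L)
  have hlim : Tendsto (fun N => ∑ n ∈ Finset.range N, g (e n) * ((y : ℕ → ℂ) n - L)) atTop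
      (𝓝 (g y - L * g one)) := by
    rw [Metric.tendsto_atTop]
    intro ε hε
    obtain ⟨K, hK⟩ := Metric.tendsto_atTop.1 hy (ε / (C + 1)) (by positivity)
    refine ⟨K, fun N hN => ?_⟩
    -- The remainder of the expansion: it vanishes before `N` and equals `y m - L` from `N` on.
    let z : convSeq := y - L • one - ∑ n ∈ Finset.range N, ((y : ℕ → ℂ) n - L) • e n
    have hz : g z =
        g y - L * g one - ∑ n ∈ Finset.range N, g (e n) * ((y : ℕ → ℂ) n - L) := by
      simp only [z, map_sub, map_smul, map_sum, smul_eq_mul]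
      simp_rw [mul_comm]
    have hzle : supSeminorm convSeq.subtype convSeq_bddAbove z ≤ ε / (C + 1) := by
      refine supSeminorm_le _ _ fun m => ?_
      have : (z : ℕ → ℂ) m = (y : ℕ → ℂ) m - L -
          (if m ∈ Finset.range N then (y : ℕ → ℂ) m - L else 0) := by
        rw [← hcoe (Finset.range N) (fun m => (y : ℕ → ℂ) m - L) m]
        simp [z, one]
      rw [Submodule.subtype_apply, this]
      split_ifs with h
      · simp only [sub_self, norm_zero]
        positivity
      · rw [sub_zero, ← dist_eq_norm]
        exact (hK m (by simp at h; omega)).le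
    rw [dist_comm, dist_eq_norm, ← hz]
    calc ‖g z‖ ≤ C * (ε / (C + 1)) := (hg z).trans (mul_le_mul_of_nonneg_left hzle hC)
      _ < ε := by
        rw [mul_div_assoc', div_lt_iff₀ (by positivity)]
        nlinarith
  have := tendsto_nhds_unique hlim hs.tendsto_sum_nat
  linear_combination this

/-- A functional dominated by the supremum norm of a linear map into the convergent sequences. -/
theorem exists_functional_rep {E : Type*} [AddCommGroup E] [Module ℂ E] (T : E →ₗ[ℂ] (ℕ → ℂ))
    (hT : ∀ x, BddAbove (Set.range fun n => ‖T x n‖))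
    (hconv : ∀ x, ∃ L : ℂ, Tendsto (T x) atTop (𝓝 L)) (f : E →ₗ[ℂ] ℂ) {C : ℝ} (hC : 0 ≤ C)
    (hf : ∀ x, ‖f x‖ ≤ C * supSeminorm T hT x) :
    ∃ t : ℕ → ℂ, ∃ μ : ℂ, (Summable fun n => ‖t n‖) ∧ ∀ (x : E) (L : ℂ),
      Tendsto (T x) atTop (𝓝 L) → f x = ∑' n, t n * T x n + μ * L := by
  obtain ⟨g, hfg, hg⟩ := exists_factor_of_le_seminorm (T.codRestrict convSeq hconv)
    (C.toNNReal • supSeminorm convSeq.subtype convSeq_bddAbove) f (fun x => by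
      refine (hf x).trans ?_
      change _ ≤ (C.toNNReal : ℝ) * _
      rw [Real.coe_toNNReal C hC]
      exact le_rfl)
  obtain ⟨t, μ, ht, h⟩ := exists_functional_rep_convSeq g (C := C) (fun y => by
    refine (hg y).trans ?_
    change (C.toNNReal : ℝ) * _ ≤ _
    rw [Real.coe_toNNReal C hC])
  exact ⟨t, μ, ht, fun x L hx => (hfg x).trans (h (T.codRestrict convSeq hconv x) L hx)⟩

/-! ### Representations of functionals on `c_A` -/

theorem seriesSum_eq {u : ℕ → ℂ} {s : ℂ}
    (h : Tendsto (fun m => ∑ k ∈ Finset.range m, u k) atTop (𝓝 s)) : seriesSum u = s :=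
  h.limUnder_eq

theorem tendsto_sum_range_of_support {u : ℕ → ℂ} {j : ℕ} (h : ∀ k, k ≠ j → u k = 0) :
    Tendsto (fun m => ∑ k ∈ Finset.range m, u k) atTop (𝓝 (u j)) :=
  tendsto_const_nhds.congr' ((eventually_gt_atTop j).mono fun _ hm =>
    (Finset.sum_eq_single_of_mem j (Finset.mem_range.2 hm) fun k _ hk => h k hk).symm)

theorem limFun_tendsto {A : Matrix ℕ ℕ ℂ} (x : cDom A) :
    Tendsto (transform A x) atTop (𝓝 (limFun A x)) :=
  tendsto_nhds_limUnder x.2.2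

theorem norm_transform_le {A : Matrix ℕ ℕ ℂ} (x : cDom A) (n : ℕ) :
    ‖transform A x n‖ ≤ rhoZero A x :=
  le_supSeminorm (transformₗ A) _ x n

theorem norm_limFun_le {A : Matrix ℕ ℕ ℂ} (x : cDom A) : ‖limFun A x‖ ≤ rhoZero A x :=
  le_of_tendsto (limFun_tendsto x).norm (Eventually.of_forall (norm_transform_le x))

theorem summable_mul_transform {A : Matrix ℕ ℕ ℂ} {t : ℕ → ℂ} (ht : Summable fun n => ‖t n‖)
    (x : cDom A) : Summable fun n => t n * transform A x n := by
  refine Summable.of_norm_bounded (ht.mul_right (rhoZero A x)) fun n => ?_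
  rw [norm_mul]
  exact mul_le_mul_of_nonneg_left (norm_transform_le x n) (norm_nonneg _)

theorem RepresentedWith.zero (A : Matrix ℕ ℕ ℂ) : RepresentedWith A 0 0 := by
  have h0 : ∀ x : ℕ → ℂ, Tendsto (fun m => ∑ k ∈ Finset.range m, (0 : ℕ → ℂ) k * x k) atTop
      (𝓝 0) := fun x => by simp
  refine ⟨0, fun x _ => ⟨0, h0 x⟩, 0, by simp, fun x => ?_⟩
  rw [seriesSum_eq (h0 x)]
  simp

theorem RepresentedWith.add {A : Matrix ℕ ℕ ℂ} {f g : cDom A →ₗ[ℂ] ℂ} {μ ν : ℂ}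
    (hf : RepresentedWith A f μ) (hg : RepresentedWith A g ν) :
    RepresentedWith A (f + g) (μ + ν) := by
  obtain ⟨b, hb, t, ht, hf⟩ := hf
  obtain ⟨c, hc, s, hs, hg⟩ := hg
  have hbc : ∀ x ∈ (cDom A : Set (ℕ → ℂ)),
      Tendsto (fun m => ∑ k ∈ Finset.range m, (b + c) k * x k) atTop
        (𝓝 (seriesSum (fun k => b k * x k) + seriesSum fun k => c k * x k)) := fun x hx => by
    simpa only [Pi.add_apply, add_mul] using tendsto_add (hb x hx) (hc x hx)
  refine ⟨b + c, fun x hx => ⟨_, hbc x hx⟩, t + s,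
    (ht.add hs).of_nonneg_of_le (fun _ => norm_nonneg _) fun n => norm_add_le _ _, fun x => ?_⟩
  have hts : ∑' n, (t + s) n * transform A x n =
      ∑' n, t n * transform A x n + ∑' n, s n * transform A x n := by
    rw [← (summable_mul_transform ht x).tsum_add (summable_mul_transform hs x)]
    simp only [Pi.add_apply, add_mul]
  rw [LinearMap.add_apply, hf, hg, hts, seriesSum_eq (hbc x x.2)]
  ring

theorem exists_representedWith_sum {ι : Type*} {A : Matrix ℕ ℕ ℂ} (s : Finset ι)
    (g : ι → cDom A →ₗ[ℂ] ℂ) (h : ∀ i, ∃ μ, RepresentedWith A (g i) μ) :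
    ∃ μ, RepresentedWith A (∑ i ∈ s, g i) μ := by
  classical
  induction s using Finset.induction_on with
  | empty => exact ⟨0, by simpa using RepresentedWith.zero A⟩
  | insert a s ha ih =>
    obtain ⟨μ, hμ⟩ := h a
    obtain ⟨ν, hν⟩ := ih
    exact ⟨μ + ν, by rw [Finset.sum_insert ha]; exact hμ.add hν⟩

theorem exists_representedWith_of_le_rhoZero {A : Matrix ℕ ℕ ℂ} (f : cDom A →ₗ[ℂ] ℂ) {C : ℝ}
    (hC : 0 ≤ C) (hf : ∀ x, ‖f x‖ ≤ C * rhoZero A x) : ∃ μ, RepresentedWith A f μ := by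
  obtain ⟨t, μ, ht, h⟩ := exists_functional_rep (transformₗ A) _ (fun x => x.2.2) f hC hf
  have h0 : ∀ x : ℕ → ℂ, Tendsto (fun m => ∑ k ∈ Finset.range m, (0 : ℕ → ℂ) k * x k) atTop
      (𝓝 0) := fun x => by simp
  refine ⟨μ, 0, fun x _ => ⟨0, h0 x⟩, t, ht, fun x => ?_⟩
  rw [seriesSum_eq (h0 x), zero_add]
  exact h x _ (limFun_tendsto x)

theorem exists_representedWith_of_le_rho {A : Matrix ℕ ℕ ℂ} (f : cDom A →ₗ[ℂ] ℂ) (j : ℕ) {C : ℝ}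
    (hf : ∀ x, ‖f x‖ ≤ C * rho A j x) : ∃ μ, RepresentedWith A f μ := by
  obtain ⟨g, hfg, -⟩ := exists_factor_of_le_seminorm ((LinearMap.proj j).comp (cDom A).subtype)
    (C.toNNReal • normSeminorm ℂ ℂ) f (fun x => (hf x).trans
      (mul_le_mul_of_nonneg_right (Real.le_coe_toNNReal C) (apply_nonneg _ _)))
  let b : ℕ → ℂ := Pi.single j (g 1)
  have hb : ∀ x : ℕ → ℂ, Tendsto (fun m => ∑ k ∈ Finset.range m, b k * x k) atTop
      (𝓝 (b j * x j)) := fun x => tendsto_sum_range_of_support fun k hk => by simp [b, hk]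
  refine ⟨0, b, fun x _ => ⟨_, hb x⟩, 0, by simp, fun x => ?_⟩
  rw [seriesSum_eq (hb x), hfg x]
  have : g (((LinearMap.proj j).comp (cDom A).subtype) x) = (x : ℕ → ℂ) j • g 1 := by
    rw [← map_smul, smul_eq_mul, mul_one]
    rfl
  rw [this]
  simp [b, mul_comm]

/-- Summation by parts for an absolutely convergent series of multiples of the partial sums of a
convergent series. -/
theorem tendsto_sum_mul_tail {t a : ℕ → ℂ} (ht : Summable fun n => ‖t n‖)
    (ha : SeriesConverges a) :
    Tendsto (fun K => ∑ k ∈ Finset.range K, a k * ∑' m, if k < m then t m else 0) atTop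
      (𝓝 (∑' m, t m * ∑ k ∈ Finset.range m, a k)) := by
  obtain ⟨M, hM⟩ := (ha.tendsto.norm).bddAbove_range
  have hsub : ∀ k, Summable fun m => if k < m then t m else 0 := fun k =>
    Summable.of_norm_bounded ht fun m => by split_ifs <;> simp
  have hswap : ∀ K, ∑ k ∈ Finset.range K, a k * ∑' m, (if k < m then t m else 0) =
      ∑' m, t m * ∑ k ∈ Finset.range (min K m), a k := fun K => by
    simp_rw [← tsum_mul_left]
    rw [← Summable.tsum_finsetSum fun k _ => (hsub k).mul_left (a k)]
    refine tsum_congr fun m => ?_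
    -- After the sums are interchanged, `t m` multiplies the terms with `k < K` and `k < m`; for `K
    -- ≥ m` this is the full partial sum.
    have : Finset.range (min K m) = (Finset.range K).filter (· < m) := by
      ext k
      simp
    rw [this, Finset.sum_filter, Finset.mul_sum]
    refine Finset.sum_congr rfl fun k _ => ?_
    split_ifs <;> simp [mul_comm]
  simp_rw [hswap]
  refine tendsto_tsum_of_dominated_convergence (bound := fun m => ‖t m‖ * M) (ht.mul_right M)
    (fun m => ?_) (Eventually.of_forall fun K m => ?_)
  · refine tendsto_const_nhds.congr' ((eventually_ge_atTop m).mono fun K hK => ?_)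
    simp only [min_eq_right hK]
  · rw [norm_mul]
    exact mul_le_mul_of_nonneg_left (hM ⟨_, rfl⟩) (norm_nonneg _)

/-- The functional depends on the partial sums of row `n`, whose limit is $(Ax)_n$. Its limit
coefficient therefore becomes the `n`-th entry of `t`, not the `μ` of the representation. Summation
by parts moves the $\ell^1$-part into $\beta_k=a_{nk}\sum_{m>k}t_m$. -/
theorem exists_representedWith_of_le_rowSeminorm {A : Matrix ℕ ℕ ℂ} (f : cDom A →ₗ[ℂ] ℂ) (n : ℕ)
    {C : ℝ} (hC : 0 ≤ C) (hf : ∀ x, ‖f x‖ ≤ C * rowSeminorm A n x) :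
    ∃ μ, RepresentedWith A f μ := by
  obtain ⟨t, μ, ht, h⟩ := exists_functional_rep (rowPartial A n) _ (fun x => x.2.1 n) f hC hf
  let b : ℕ → ℂ := fun k => A n k * ∑' m, if k < m then t m else 0
  have hb : ∀ x ∈ (cDom A : Set (ℕ → ℂ)),
      Tendsto (fun m => ∑ k ∈ Finset.range m, b k * x k) atTop
        (𝓝 (∑' m, t m * ∑ k ∈ Finset.range m, A n k * x k)) := fun x hx => by
    simpa only [b, mul_right_comm] using tendsto_sum_mul_tail ht (hx.1 n)
  refine ⟨0, b, fun x hx => ⟨_, hb x hx⟩, Pi.single n μ, ?_, fun x => ?_⟩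
  · exact summable_of_ne_finset_zero (s := {n}) fun k hk => by
      rw [Pi.single_eq_of_ne (by simpa using hk), norm_zero]
  · rw [seriesSum_eq (hb x x.2), zero_mul, add_zero,
      tsum_eq_single (f := fun k => (Pi.single n μ : ℕ → ℂ) k * transform A x k) n
        (fun k hk => by simp [hk]), Pi.single_eq_same]
    exact h x _ (x.2.1 n).tendsto

/-- Every functional bounded by finitely many of the seminorms of `c_A` has a representation. -/
theorem exists_representedWith {A : Matrix ℕ ℕ ℂ} (f : cDom A →ₗ[ℂ] ℂ)
    (hf : ∃ s : Finset (Unit ⊕ ℕ ⊕ ℕ), ∃ C : NNReal, ∀ x, ‖f x‖ ≤ C * s.sup (cSeminorms A) x) :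
    ∃ μ, RepresentedWith A f μ := by
  obtain ⟨s, C, hC⟩ := hf
  -- The supremum of finitely many seminorms is at most their sum, so `f` splits into pieces
  -- controlled by one seminorm each.
  obtain ⟨g, rfl, hg⟩ := exists_sum_of_le_sum s (fun i => C • cSeminorms A i) f (fun x => by
    refine (hC x).trans ?_
    change _ ≤ ∑ i ∈ s, (C : ℝ) * cSeminorms A i x
    rw [← Finset.mul_sum, ← seminorm_sum_apply]
    exact mul_le_mul_of_nonneg_left (Seminorm.finset_sup_le_sum _ s x) C.2)
  refine exists_representedWith_sum s g fun i => ?_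
  rcases i with u | j | n
  · exact exists_representedWith_of_le_rhoZero _ C.2 (hg (.inl u))
  · exact exists_representedWith_of_le_rho _ j (hg (.inr (.inl j)))
  · exact exists_representedWith_of_le_rowSeminorm _ n C.2 (hg (.inr (.inr n)))

/-! ### Completeness of `c_A` and barrelledness -/

/-- The pointwise limit of a uniformly Cauchy sequence of convergent sequences converges, and the
limits converge. -/
theorem exists_tendsto_of_uniform_cauchy {y : ℕ → ℕ → ℂ} {z : ℕ → ℂ} {l : ℕ → ℂ}
    (hy : ∀ i, Tendsto (y i) atTop (𝓝 (l i)))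
    (hunif : ∀ ε > 0, ∃ N, ∀ i ≥ N, ∀ m, ‖y i m - z m‖ ≤ ε) :
    ∃ L, Tendsto z atTop (𝓝 L) ∧ Tendsto l atTop (𝓝 L) := by
  have hU : TendstoUniformlyOnFilter y z atTop atTop := by
    rw [Metric.tendstoUniformlyOnFilter_iff]
    intro ε hε
    obtain ⟨N, hN⟩ := hunif (ε / 2) (half_pos hε)
    refine ((eventually_ge_atTop N).prod_mk (Eventually.of_forall fun _ => trivial)).mono
      fun p hp => ?_
    rw [dist_comm, dist_eq_norm]
    exact (hN p.1 hp.1 p.2).trans_lt (half_lt_self hε)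
  have hl : CauchySeq l := by
    rw [Metric.cauchySeq_iff']
    intro ε hε
    obtain ⟨N, hN⟩ := hunif (ε / 4) (by linarith)
    refine ⟨N, fun n hn => ?_⟩
    have : dist (l n) (l N) ≤ ε / 2 := by
      refine le_of_tendsto ((hy n).dist (hy N)) (Eventually.of_forall fun m => ?_)
      rw [dist_eq_norm, ← sub_sub_sub_cancel_right _ _ (z m)]
      linarith [norm_sub_le (y n m - z m) (y N m - z m), hN n hn m, hN N le_rfl m]
    linarith
  obtain ⟨L, hL⟩ := cauchySeq_tendsto_of_complete hl
  exact ⟨L, hU.tendsto_of_eventually_tendsto (Eventually.of_forall hy) hL, hL⟩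

theorem norm_sub_le_of_cauchy {y : ℕ → ℕ → ℂ} {z : ℕ → ℂ}
    (hz : ∀ m, Tendsto (y · m) atTop (𝓝 (z m)))
    {ε : ℝ} {N : ℕ} (h : ∀ i ≥ N, ∀ j ≥ N, ∀ m, ‖y i m - y j m‖ ≤ ε) :
    ∀ i ≥ N, ∀ m, ‖y i m - z m‖ ≤ ε := fun i hi m =>
  le_of_tendsto ((hz m).const_sub (y i m)).norm
    ((eventually_ge_atTop N).mono fun j hj => h i hi j hj m)

theorem norm_rowPartial_le {A : Matrix ℕ ℕ ℂ} (x : cDom A) (n m : ℕ) :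
    ‖rowPartial A n x m‖ ≤ rowSeminorm A n x :=
  le_supSeminorm (rowPartial A n) _ x m

/-- `c_A` is sequentially complete. -/
theorem cDom_complete {A : Matrix ℕ ℕ ℂ} (u : ℕ → cDom A)
    (hu : ∀ i, ∀ ε > 0, ∃ N, ∀ m ≥ N, ∀ n ≥ N, cSeminorms A i (u m - u n) ≤ ε) :
    ∃ x, ∀ i, ∀ ε > 0, ∃ N, ∀ m ≥ N, cSeminorms A i (u m - x) ≤ ε := by
  have hcoord : ∀ k, ∃ a, Tendsto (fun i => (u i : ℕ → ℂ) k) atTop (𝓝 a) := fun k => by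
    refine cauchySeq_tendsto_of_complete (Metric.cauchySeq_iff.2 fun ε hε => ?_)
    obtain ⟨N, hN⟩ := hu (.inr (.inl k)) (ε / 2) (half_pos hε)
    refine ⟨N, fun m hm n hn => ?_⟩
    rw [dist_eq_norm]
    exact (hN m hm n hn).trans_lt (half_lt_self hε)
  choose x hx using hcoord
  have hpart : ∀ n m, Tendsto (fun i => rowPartial A n (u i) m) atTop
      (𝓝 (∑ k ∈ Finset.range m, A n k * x k)) := fun n m =>
    tendsto_finsetSum _ fun k _ => (hx k).const_mul _
  have hrowU : ∀ n, ∀ ε > 0, ∃ N, ∀ i ≥ N, ∀ m,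
      ‖rowPartial A n (u i) m - ∑ k ∈ Finset.range m, A n k * x k‖ ≤ ε := fun n ε hε => by
    obtain ⟨N, hN⟩ := hu (.inr (.inr n)) ε hε
    refine ⟨N, norm_sub_le_of_cauchy (hpart n) fun i hi j hj m => ?_⟩
    rw [← Pi.sub_apply, ← map_sub]
    exact (norm_rowPartial_le _ n m).trans (hN i hi j hj)
  have hrow : ∀ n, SeriesConverges (fun k => A n k * x k) ∧
      Tendsto (fun i => transform A (u i) n) atTop (𝓝 (transform A x n)) := fun n => by
    -- Uniformity in the length of the partial sums gives both the convergence of row `n` at `x` and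
    -- the interchange of the two limits.
    obtain ⟨L, hL, hL'⟩ := exists_tendsto_of_uniform_cauchy
      (fun i => ((u i).2.1 n).tendsto) (hrowU n)
    exact ⟨⟨L, hL⟩, by rwa [show transform A x n = L from seriesSum_eq hL]⟩
  have htrU : ∀ ε > 0, ∃ N, ∀ i ≥ N, ∀ n, ‖transform A (u i) n - transform A x n‖ ≤ ε :=
    fun ε hε => by
    obtain ⟨N, hN⟩ := hu (.inl ()) ε hε
    refine ⟨N, norm_sub_le_of_cauchy (fun n => (hrow n).2) fun i hi j hj n => ?_⟩
    refine le_trans (le_of_eq ?_) ((norm_transform_le (u i - u j) n).trans (hN i hi j hj))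
    exact congrArg norm (congrFun (map_sub (transformₗ A) (u i) (u j)) n).symm
  obtain ⟨L, hL, -⟩ := exists_tendsto_of_uniform_cauchy (fun i => limFun_tendsto (u i)) htrU
  let X : cDom A := ⟨x, fun n => (hrow n).1, L, hL⟩
  refine ⟨X, fun i ε hε => ?_⟩
  rcases i with i | k | n
  · obtain ⟨N, hN⟩ := htrU ε hε
    refine ⟨N, fun m hm => (ciSup_le fun n => ?_ : (⨆ n, ‖transformₗ A (u m - X) n‖) ≤ ε)⟩
    rw [map_sub]
    exact hN m hm n
  · obtain ⟨N, hN⟩ := Metric.tendsto_atTop.1 (hx k) ε hε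
    refine ⟨N, fun m hm => ?_⟩
    have := (hN m hm).le
    rw [dist_eq_norm] at this
    exact this
  · obtain ⟨N, hN⟩ := hrowU n ε hε
    refine ⟨N, fun m hm => (ciSup_le fun k => ?_ : (⨆ k, ‖rowPartial A n (u m - X) k‖) ≤ ε)⟩
    rw [map_sub]
    exact hN m hm k

/-- A space with a countable sequentially complete family of seminorms is barrelled. -/
theorem barrelledSpace_of_complete {ι E : Type*} [Countable ι] [AddCommGroup E] [Module ℂ E]
    [TopologicalSpace E] {p : SeminormFamily ℂ E ι} (hp : WithSeminorms p)
    (h : ∀ u : ℕ → E, (∀ i, ∀ ε > 0, ∃ N, ∀ m ≥ N, ∀ n ≥ N, p i (u m - u n) ≤ ε) →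
      ∃ x, ∀ i, ∀ ε > 0, ∃ N, ∀ m ≥ N, p i (u m - x) ≤ ε) : BarrelledSpace ℂ E := by
  have := hp.topologicalAddGroup
  have := hp.continuousSMul
  have := hp.firstCountableTopology
  let _ : UniformSpace E := IsTopologicalAddGroup.rightUniformSpace E
  have : IsUniformAddGroup E := isUniformAddGroup_of_addCommGroup
  have : (uniformity E).IsCountablyGenerated := IsUniformAddGroup.uniformity_countably_generated
  have : CompleteSpace E := by
    refine UniformSpace.complete_of_cauchySeq_tendsto fun u hu => ?_
    obtain ⟨x, hx⟩ := h u fun i ε hε => by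
      have hV : {z : E × E | p i (z.2 - z.1) < ε} ∈ uniformity E := by
        rw [uniformity_eq_comap_nhds_zero]
        refine ⟨{z | p i z < ε}, ?_, fun _ hz => hz⟩
        exact (hp.continuous_seminorm i).continuousAt.eventually_lt continuousAt_const
          (by simpa using hε)
      obtain ⟨N, hN⟩ := cauchySeq_iff.1 hu _ hV
      exact ⟨N, fun m hm n hn => (hN n hn m hm).le⟩
    refine ⟨x, (hp.tendsto_nhds_atTop u x).2 fun i ε hε => ?_⟩
    obtain ⟨N, hN⟩ := hx i (ε / 2) (half_pos hε)
    exact ⟨N, fun m hm => (hN m hm).trans_lt (half_lt_self hε)⟩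
  -- Countably many seminorms make the uniformity pseudometrizable; with completeness, Baire's
  -- theorem gives barrelledness.
  let _ : PseudoMetricSpace E := UniformSpace.pseudoMetricSpace E
  infer_instance

/-- The supremum seminorm of a linear map with continuous coordinates on a barrelled space is
continuous. -/
theorem continuous_supSeminorm {E : Type*} [AddCommGroup E] [Module ℂ E] [TopologicalSpace E]
    [BarrelledSpace ℂ E] (T : E →ₗ[ℂ] (ℕ → ℂ))
    (hT : ∀ x, BddAbove (Set.range fun n => ‖T x n‖)) (hc : ∀ n, Continuous fun x => T x n) :
    Continuous (supSeminorm T hT) :=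
  (supSeminorm T hT).continuous_of_lowerSemicontinuous
    (lowerSemicontinuous_ciSup hT fun n => (hc n).norm.lowerSemicontinuous)

/-! ### The FK-space `c_A` and the inclusion into `c_D` -/

/-- The seminorms of `c_A` on the type of elements of the FK-space `c_A`. -/
def elemSeminorms (A : Matrix ℕ ℕ ℂ) (hA : phi ≤ cDom A) :
    SeminormFamily ℂ (cSpace A hA).Elem (Unit ⊕ ℕ ⊕ ℕ) :=
  cSeminorms A

theorem withSeminorms_elemSeminorms (A : Matrix ℕ ℕ ℂ) (hA : phi ≤ cDom A) :
    WithSeminorms (elemSeminorms A hA) :=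
  ⟨rfl⟩

theorem continuous_elem_iff {A : Matrix ℕ ℕ ℂ} {hA : phi ≤ cDom A}
    (f : (cSpace A hA).Elem →ₗ[ℂ] ℂ) :
    Continuous f ↔ ∃ s : Finset (Unit ⊕ ℕ ⊕ ℕ), ∃ C : NNReal, ∀ x : (cSpace A hA).Elem,
      ‖f x‖ ≤ C * s.sup (elemSeminorms A hA) x :=
  continuous_functional_iff (withSeminorms_elemSeminorms A hA) f

/-- The elements of the FK-space `c_A` are the elements of `cDom A`. -/
def ofElem (A : Matrix ℕ ℕ ℂ) (hA : phi ≤ cDom A) : (cSpace A hA).Elem →ₗ[ℂ] cDom A where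
  toFun x := x
  map_add' _ _ := rfl
  map_smul' _ _ := rfl

theorem inDual_iff {A : Matrix ℕ ℕ ℂ} (hA : phi ≤ cDom A) (f : cDom A →ₗ[ℂ] ℂ) :
    InDual A f ↔ Continuous (f.comp (ofElem A hA)) :=
  Iff.rfl

theorem exists_representedWith_of_inDual {A : Matrix ℕ ℕ ℂ} (hA : phi ≤ cDom A)
    {f : cDom A →ₗ[ℂ] ℂ} (hf : InDual A f) : ∃ μ, RepresentedWith A f μ :=
  exists_representedWith f ((continuous_elem_iff (hA := hA) f).1 hf)

instance (A : Matrix ℕ ℕ ℂ) (hA : phi ≤ cDom A) : BarrelledSpace ℂ (cSpace A hA).Elem :=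
  barrelledSpace_of_complete (withSeminorms_elemSeminorms A hA) cDom_complete

theorem inDual_of_le_cSeminorms {A : Matrix ℕ ℕ ℂ} (hA : phi ≤ cDom A) (f : cDom A →ₗ[ℂ] ℂ)
    (i : Unit ⊕ ℕ ⊕ ℕ) (hf : ∀ x, ‖f x‖ ≤ cSeminorms A i x) : InDual A f :=
  (continuous_elem_iff (hA := hA) f).2 ⟨{i}, 1, fun x => by
    rw [Finset.sup_singleton, NNReal.coe_one, one_mul]
    exact hf x⟩

theorem inDual_coord {A : Matrix ℕ ℕ ℂ} (hA : phi ≤ cDom A) (k : ℕ) :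
    InDual A ((LinearMap.proj k).comp (cDom A).subtype) :=
  inDual_of_le_cSeminorms hA _ (.inr (.inl k)) fun _ => le_rfl

/-- The inclusion `c_A → c_D` as a linear map between the FK-spaces. -/
def elemInclusion {A D : Matrix ℕ ℕ ℂ} (hA : phi ≤ cDom A) (hAD : cDom A ≤ cDom D) :
    (cSpace A hA).Elem →ₗ[ℂ] (cSpace D (hA.trans hAD)).Elem where
  toFun x := Submodule.inclusion hAD (ofElem A hA x)
  map_add' _ _ := rfl
  map_smul' _ _ := rfl

/-- The inclusion `c_A → c_D` of FK-spaces is continuous. -/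
theorem continuous_elemInclusion {A D : Matrix ℕ ℕ ℂ} (hA : phi ≤ cDom A)
    (hAD : cDom A ≤ cDom D) : Continuous (elemInclusion hA hAD) := by
  have := (withSeminorms_elemSeminorms A hA).topologicalAddGroup
  let J : (cSpace A hA).Elem →ₗ[ℂ] cDom D := (Submodule.inclusion hAD).comp (ofElem A hA)
  -- Continuity climbs from coordinates to partial row sums, then by barrelledness to their
  -- supremum. That supremum dominates $(Dx)_n$, and a second use of barrelledness reaches
  -- $\sup_n|(Dx)_n|$.
  have hcoord : ∀ k, Continuous fun x => (J x : ℕ → ℂ) k := fun k => inDual_coord hA k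
  have hpart : ∀ n m, Continuous fun x => rowPartial D n (J x) m := fun n m =>
    continuous_finsetSum (Finset.range m) fun k _ => (hcoord k).const_mul (D n k)
  have hrow : ∀ n, Continuous ((rowSeminorm D n).comp J) := fun n =>
    continuous_supSeminorm ((rowPartial D n).comp J)
      (fun x => (((J x).2.1 n).tendsto.norm).bddAbove_range) (hpart n)
  have htr : ∀ n, Continuous fun x => transformₗ D (J x) n := fun n => by
    let T : (cSpace A hA).Elem →ₗ[ℂ] ℂ := ((LinearMap.proj n).comp (transformₗ D)).comp J
    refine (norm_withSeminorms ℂ ℂ).continuous_of_continuous_comp T fun _ => ?_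
    refine Seminorm.continuous_of_le (hrow n) fun x => ?_
    exact le_of_tendsto ((J x).2.1 n).tendsto.norm
      (Eventually.of_forall (norm_rowPartial_le (J x) n))
  refine (withSeminorms_elemSeminorms D _).continuous_of_continuous_comp _ fun i => ?_
  rcases i with i | k | n
  · exact continuous_supSeminorm ((transformₗ D).comp J)
      (fun x => ((J x).2.2.choose_spec.norm).bddAbove_range) htr
  · exact (hcoord k).norm
  · exact hrow n

/-! ### Functionals along the deferred sections -/

theorem map_deferredSect (X : SeqSpace) (g : X.Elem →ₗ[ℂ] ℂ) (p q : ℕ → ℕ) (x : ℕ → ℂ) (n : ℕ) :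
    g (X.deferredSect p q x n) = ((q n : ℂ) - (p n : ℂ))⁻¹ *
      ∑ k ∈ Finset.Ioc (p n) (q n), ∑ j ∈ Finset.range k, g (X.delta j) * x j := by
  simp only [SeqSpace.deferredSect, SeqSpace.sect, map_smul, map_sum, smul_eq_mul, mul_comm (x _)]

theorem tendsto_map_deferredSect {X : SeqSpace} (g : X.Elem →ₗ[ℂ] ℂ) {p q : ℕ → ℕ}
    (hpq : ∀ n, p n < q n) (hq : Tendsto q atTop atTop) {x : ℕ → ℂ} {s : ℂ}
    (h : Tendsto (fun m => ∑ j ∈ Finset.range m, g (X.delta j) * x j) atTop (𝓝 s)) :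
    Tendsto (fun n => g (X.deferredSect p q x n)) atTop (𝓝 s) := by
  simp_rw [map_deferredSect]
  exact tendsto_deferred_mean hpq hq h

theorem elemInclusion_deferredSect {A D : Matrix ℕ ℕ ℂ} (hA : phi ≤ cDom A)
    (hAD : cDom A ≤ cDom D) (p q : ℕ → ℕ) (x : ℕ → ℂ) (n : ℕ) :
    elemInclusion hA hAD ((cSpace A hA).deferredSect p q x n) =
      (cSpace D (hA.trans hAD)).deferredSect p q x n := by
  simp only [SeqSpace.deferredSect, SeqSpace.sect, map_smul, map_sum]
  rfl

/-- The functional `x ↦ ∑ β_k x_k` on `c_A` given by an element of the `β`-dual. -/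
def betaFun {A : Matrix ℕ ℕ ℂ} {b : ℕ → ℂ} (hb : b ∈ betaDual (cDom A : Set (ℕ → ℂ))) :
    cDom A →ₗ[ℂ] ℂ where
  toFun x := seriesSum fun k => b k * (x : ℕ → ℂ) k
  map_add' x y := seriesSum_eq (by
    simpa only [Submodule.coe_add, Pi.add_apply, mul_add] using
      tendsto_add (hb x x.2) (hb y y.2))
  map_smul' c x := seriesSum_eq (by
    simpa only [Submodule.coe_smul, Pi.smul_apply, smul_eq_mul, mul_left_comm,
      RingHom.id_apply] using
      tendsto_smul c (hb x x.2))

theorem seriesSum_mul_single (b : ℕ → ℂ) (j : ℕ) :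
    seriesSum (fun k => b k * (Pi.single j 1 : ℕ → ℂ) k) = b j := by
  rw [seriesSum_eq (tendsto_sum_range_of_support (j := j) fun k hk => by simp [hk])]
  simp

theorem tendsto_betaFun_deferredSect {A : Matrix ℕ ℕ ℂ} (hA : phi ≤ cDom A) {p q : ℕ → ℕ}
    (hpq : ∀ n, p n < q n) (hq : Tendsto q atTop atTop) {b : ℕ → ℂ}
    (hb : b ∈ betaDual (cDom A : Set (ℕ → ℂ))) (x : cDom A) :
    Tendsto (fun n => betaFun hb (ofElem A hA ((cSpace A hA).deferredSect p q x n))) atTop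
      (𝓝 (betaFun hb x)) := by
  refine tendsto_map_deferredSect ((betaFun hb).comp (ofElem A hA)) hpq hq ?_
  have : ∀ j, (betaFun hb).comp (ofElem A hA) ((cSpace A hA).delta j) = b j :=
    seriesSum_mul_single b
  simp_rw [this]
  exact (hb x x.2).tendsto

/-- Each row of `A` belongs to the `β`-dual of `c_A`. -/
theorem tendsto_transform_deferredSect {A : Matrix ℕ ℕ ℂ} (hA : phi ≤ cDom A) {p q : ℕ → ℕ}
    (hpq : ∀ n, p n < q n) (hq : Tendsto q atTop atTop) (x : cDom A) (m : ℕ) :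
    Tendsto (fun n => transform A (ofElem A hA ((cSpace A hA).deferredSect p q x n)) m) atTop
      (𝓝 (transform A x m)) :=
  tendsto_betaFun_deferredSect hA hpq hq (b := A m) (fun _ hy => hy.1 m) x

/-- On an element with bounded deferred Cesàro sections, a represented functional fails to be
the limit of its values on the sections by exactly `μ` times the failure of `lim_A`. -/
theorem RepresentedWith.tendsto_deferredSect {A : Matrix ℕ ℕ ℂ} (hA : phi ≤ cDom A) {p q : ℕ → ℕ}
    (hpq : ∀ n, p n < q n) (hq : Tendsto q atTop atTop) {f : cDom A →ₗ[ℂ] ℂ} {μ : ℂ}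
    (hf : RepresentedWith A f μ) {x : cDom A} (hx : (x : ℕ → ℂ) ∈ DB p q (cSpace A hA)) :
    Tendsto (fun n => f (ofElem A hA ((cSpace A hA).deferredSect p q x n)) - f x -
      μ * (limFun A (ofElem A hA ((cSpace A hA).deferredSect p q x n)) - limFun A x))
      atTop (𝓝 0) := by
  obtain ⟨b, hb, t, ht, hf⟩ := hf
  -- Boundedness of the sections is used only through `ρ₀`: it supplies the dominating series `‖t m‖
  -- * M`.
  obtain ⟨M, hM⟩ := (withSeminorms_elemSeminorms A hA).isVonNBounded_iff_seminorm_bddAbove.1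
    hx.2 (.inl ())
  have hbd : ∀ n, rhoZero A (ofElem A hA ((cSpace A hA).deferredSect p q x n)) ≤ M :=
    fun n => hM ⟨_, ⟨n, rfl⟩, rfl⟩
  have ht' : Tendsto (fun n => ∑' m, t m *
      transform A (ofElem A hA ((cSpace A hA).deferredSect p q x n)) m) atTop
      (𝓝 (∑' m, t m * transform A x m)) := by
    refine tendsto_tsum_of_dominated_convergence (bound := fun m => ‖t m‖ * M) (ht.mul_right M)
      (fun m => (tendsto_transform_deferredSect hA hpq hq x m).const_mul _)
      (Eventually.of_forall fun n m => ?_)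
    rw [norm_mul]
    exact mul_le_mul_of_nonneg_left ((norm_transform_le _ m).trans (hbd n)) (norm_nonneg _)
  have h := ((tendsto_betaFun_deferredSect hA hpq hq hb x).add ht').sub_const
    (betaFun hb x + ∑' m, t m * transform A x m)
  rw [sub_self] at h
  refine h.congr fun n => ?_
  rw [hf, hf]
  change (betaFun hb _ + _ : ℂ) - _ = betaFun hb _ + _ + _ - (betaFun hb _ + _ + _) - _
  ring

theorem DW_subset_DB {A : Matrix ℕ ℕ ℂ} (hA : phi ≤ cDom A) (p q : ℕ → ℕ) :
    DW p q (cSpace A hA) ⊆ DB p q (cSpace A hA) := fun x ⟨hx, h⟩ => by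
  refine ⟨hx, isVonNBounded_of_weakly_bounded (withSeminorms_elemSeminorms A hA) _ fun f => ?_⟩
  obtain ⟨M, hM⟩ := (h f).norm.bddAbove_range
  exact ⟨M, fun n => hM ⟨n, rfl⟩⟩

/-- Every continuous functional has a representation, so on bounded sections $\lim_A$ is the only
obstruction to weak convergence. -/
theorem mem_DW_of_tendsto_limFun {A : Matrix ℕ ℕ ℂ} (hA : phi ≤ cDom A) {p q : ℕ → ℕ}
    (hpq : ∀ n, p n < q n) (hq : Tendsto q atTop atTop) {x : cDom A}
    (hx : (x : ℕ → ℂ) ∈ DB p q (cSpace A hA))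
    (h : Tendsto (fun n => limFun A (ofElem A hA ((cSpace A hA).deferredSect p q x n))) atTop
      (𝓝 (limFun A x))) : (x : ℕ → ℂ) ∈ DW p q (cSpace A hA) := by
  refine ⟨x.2, fun f => ?_⟩
  let f' : cDom A →ₗ[ℂ] ℂ := f.toLinearMap
  obtain ⟨μ, hμ⟩ := exists_representedWith_of_inDual hA (f := f') f.continuous
  have h1 := ((hμ.tendsto_deferredSect hA hpq hq hx).add
    ((h.sub_const (limFun A x)).const_mul μ)).add_const (f' x)
  rw [sub_self, mul_zero, add_zero, zero_add] at h1
  refine h1.congr fun n => ?_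
  rw [sub_add_cancel, sub_add_cancel]
  rfl

theorem inDual_limFun {A : Matrix ℕ ℕ ℂ} (hA : phi ≤ cDom A) : InDual A (limFun A) :=
  inDual_of_le_cSeminorms hA _ (.inl ()) norm_limFun_le

theorem inDual_limRestrict {A D : Matrix ℕ ℕ ℂ} (hA : phi ≤ cDom A) (hAD : cDom A ≤ cDom D) :
    InDual A (limRestrict hAD) :=
  (inDual_iff hA _).2
    (((inDual_iff (hA.trans hAD) _).1 (inDual_limFun (hA.trans hAD))).comp
      (continuous_elemInclusion hA hAD))

theorem DB_subset_DB {A D : Matrix ℕ ℕ ℂ} (hA : phi ≤ cDom A) (hAD : cDom A ≤ cDom D)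
    (p q : ℕ → ℕ) : DB p q (cSpace A hA) ⊆ DB p q (cSpace D (hA.trans hAD)) := fun x hx => by
  refine ⟨hAD hx.1, ?_⟩
  have h := hx.2.image (⟨elemInclusion hA hAD, continuous_elemInclusion hA hAD⟩ :
    (cSpace A hA).Elem →L[ℂ] (cSpace D (hA.trans hAD)).Elem)
  rw [← Set.range_comp] at h
  change Bornology.IsVonNBounded ℂ
    (Set.range fun n => elemInclusion hA hAD ((cSpace A hA).deferredSect p q x n)) at h
  simpa only [elemInclusion_deferredSect] using h

theorem limFun_deferredSect {A D : Matrix ℕ ℕ ℂ} (hA : phi ≤ cDom A) (hAD : cDom A ≤ cDom D)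
    (p q : ℕ → ℕ) (x : ℕ → ℂ) (n : ℕ) :
    limFun D (ofElem D (hA.trans hAD) ((cSpace D (hA.trans hAD)).deferredSect p q x n)) =
      limRestrict hAD (ofElem A hA ((cSpace A hA).deferredSect p q x n)) := by
  rw [← elemInclusion_deferredSect hA hAD]
  rfl

end DeferredCesaro

end

/-! ### Uniqueness of `μ` and the conullity criterion -/

theorem mainTheorem3 (p q : ℕ → ℕ) (hpq : ∀ n, p n < q n)
    (hq : Filter.Tendsto q Filter.atTop Filter.atTop)
    (A D : Matrix ℕ ℕ ℂ)
    (hφ : DeferredCesaro.phi ≤ DeferredCesaro.cDom A)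
    (hAD : DeferredCesaro.cDom A ≤ DeferredCesaro.cDom D)
    (hWB : DeferredCesaro.DW p q (DeferredCesaro.cSpace A hφ) ≠
      DeferredCesaro.DB p q (DeferredCesaro.cSpace A hφ)) :
    DeferredCesaro.MuUnique A ∧
    DeferredCesaro.InDual A (DeferredCesaro.limRestrict hAD) ∧
    DeferredCesaro.RepresentedWith A (DeferredCesaro.limRestrict hAD)
      (DeferredCesaro.muInv A (DeferredCesaro.limRestrict hAD)) ∧
    (DeferredCesaro.muInv A (DeferredCesaro.limRestrict hAD) = 0 ↔
      DeferredCesaro.ConullWrt p q (DeferredCesaro.cSpace A hφ)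
        (DeferredCesaro.cSpace D (hφ.trans hAD))) := by
  open DeferredCesaro in
  obtain ⟨x, hxB, hxlim⟩ : ∃ x : cDom A, (x : ℕ → ℂ) ∈ DB p q (cSpace A hφ) ∧
      ¬ Tendsto (fun n => limFun A (ofElem A hφ ((cSpace A hφ).deferredSect p q x n)) -
        limFun A x) atTop (𝓝 0) := by
    by_contra! hcon
    refine hWB ((DW_subset_DB hφ p q).antisymm fun x hx => ?_)
    exact mem_DW_of_tendsto_limFun hφ hpq hq (x := ⟨x, hx.1⟩) hx
      (tendsto_sub_nhds_zero_iff.1 (hcon ⟨x, hx.1⟩ hx))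
  -- The test applied to `μ - ν` and to the invariant of `lim_D`: at the bad `x`, only a zero
  -- coefficient can make the defect of `lim_A` tend to 0.
  have hzero : ∀ c : ℂ, Tendsto (fun n => c *
      (limFun A (ofElem A hφ ((cSpace A hφ).deferredSect p q x n)) - limFun A x)) atTop (𝓝 0) →
      c = 0 := fun c hc => by
    by_contra h
    refine hxlim ?_
    simpa [h] using hc.const_mul c⁻¹
  have hdual := inDual_limRestrict hφ hAD
  have hrep : RepresentedWith A (limRestrict hAD) (muInv A (limRestrict hAD)) := by
    have h := exists_representedWith_of_inDual hφ hdual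
    rw [muInv, dif_pos h]
    exact h.choose_spec
  refine ⟨fun f _ μ ν hμ hν => ?_, hdual, hrep, fun h0 y hy => ?_, fun hcon => ?_⟩
  · refine sub_eq_zero.1 (hzero (μ - ν) ?_)
    have h := (hν.tendsto_deferredSect hφ hpq hq hxB).sub
      (hμ.tendsto_deferredSect hφ hpq hq hxB)
    rw [sub_zero] at h
    exact h.congr fun n => by ring
  · refine mem_DW_of_tendsto_limFun (hφ.trans hAD) hpq hq (x := ⟨y, hAD hy.1⟩)
      (DB_subset_DB hφ hAD p q hy) ?_
    have h := hrep.tendsto_deferredSect hφ hpq hq (x := ⟨y, hy.1⟩) hy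
    simp_rw [h0, zero_mul, sub_zero] at h
    simp_rw [limFun_deferredSect hφ hAD]
    exact tendsto_sub_nhds_zero_iff.1 h
  · refine hzero _ ?_
    obtain ⟨hxD, hw⟩ := hcon hxB
    -- Weak convergence in `c_D` is needed for the single functional `lim_D`.
    have h1 := hw ⟨(limFun D).comp (ofElem D (hφ.trans hAD)), inDual_limFun (hφ.trans hAD)⟩
    have h2 : Tendsto (fun n => limRestrict hAD
        (ofElem A hφ ((cSpace A hφ).deferredSect p q x n))) atTop (𝓝 (limRestrict hAD x)) :=
      h1.congr fun n => limFun_deferredSect hφ hAD p q x n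
    have h := (tendsto_sub_nhds_zero_iff.2 h2).sub (hrep.tendsto_deferredSect hφ hpq hq hxB)
    rw [sub_zero] at h
    exact h.congr fun n => by ring
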